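/- Let $X^{(1)},X^{(2)},\dots$ be an irreducible time-homogeneous Markov chain with finite state space $\mathcal Y$ (not necessarily stationary: the law of $X^{(1)}$ is arbitrary), transition matrix $\mathbf P=[p_{i,j}]_{i,j\in\mathcal Y}$ and invariant distribution $\pi=[p_i]_{i\in\mathcal Y}$, and let $$H(\mathbf P|\pi)=-\sum_{i,j\in\mathcal Y}p_i\,p_{i,j}\log_2 p_{i,j}.$$ Write $X^n=[X^{(1)},\dots,X^{(n)}]$. Let $\mathbb F$ be a finite field and let $\Phi:\mathcal Y\to\mathbb F$ be any injection (in particular, $\mathcal Y=\mathbb F$ and $\Phi=\mathrm{id}$ is allowed); $\Phi(X^n)\in\mathbb F^n$ is obtained by applying $\Phi$ to each letter. (1) Every rate $R>H(\mathbf P|\pi)$ is achievable with linear coding over $\mathbb F$: for every $\epsilon>0$ there is $N_0$ such that for every $n>N_0$ there are $k$ with $|\mathbb F|^k\le 2^{nR}$, a linear encoder $\phi:\mathbb F^n\to\mathbb F^k$, $\phi(\mathbf z)=\mathbf A\mathbf z$ for a matrix $\mathbf A$ over $\mathbb F$, and a decoder $\psi:\mathbb F^k\to\mathcal Y^n$ with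 $$\Pr\{\psi(\phi(\Phi(X^n)))\neq X^n\}<\epsilon.$$ Moreover, for every $R>H(\mathbf P|\pi)$ and $\epsilon>0$ there is $N_0$ such that, for all $n>N_0$ and all $k\ge nR/\log_2|\mathbb F|$, there are a linear encoder $\phi:\mathbb F^n\to\mathbb F^k$ and a decoder $\psi:\mathbb F^k\to\mathcal Y^n$ with this error bound. (2) This matches the optimal compression rate: no rate $R<H(\mathbf P|\pi)$ is achievable by any encoders. That is, for $R<H(\mathbf P|\pi)$ it is not true that for every $\epsilon>0$ there is $N_0$ such that for every $n>N_0$ there are arbitrary maps $\phi:\mathcal Y^n\to\{m\in\mathbb Z: 1\le m\le 2^{nR}\}$ and $\psi:\{m\in\mathbb Z: 1\le m\le 2^{nR}\}\to\mathcal Y^n$ with $\Pr\{\psi(\phi(X^n))\ne X^n\}<\epsilon$. -/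

import Mathlib

open scoped Matrix

namespace MarkovCoding

/-- `X 0, X 1, X 2, …` (the letters `X⁽¹⁾, X⁽²⁾, X⁽³⁾, …`) is a time-homogeneous Markov chain with
state space `S` and transition matrix `P` on the probability space `(Ω, μ)`: `P` is a stochastic
matrix and, given any past of positive probability, the next letter is distributed according to
the row of `P` indexed by the present letter. The law of `X 0` is arbitrary. -/
structure IsMarkovChain {Ω S : Type*} [MeasurableSpace Ω] [Fintype S] [MeasurableSpace S]
    (μ : MeasureTheory.Measure Ω) (X : ℕ → Ω → S) (P : Matrix S S ℝ) : Prop where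
  measurable : ∀ n, Measurable (X n)
  nonneg : ∀ i j, 0 ≤ P i j
  row_sum : ∀ i, ∑ j, P i j = 1
  transition : ∀ (n : ℕ) (x : ℕ → S) (j : S), μ {ω | ∀ i ≤ n, X i ω = x i} ≠ 0 →
    (ProbabilityTheory.cond μ {ω | ∀ i ≤ n, X i ω = x i}).real {ω | X (n + 1) ω = j} = P (x n) j

/-- `π` is an invariant distribution of `P`: a probability vector with `π P = π`. -/
def IsInvariantDistribution {S : Type*} [Fintype S] (π : S → ℝ) (P : Matrix S S ℝ) : Prop :=
  π ∈ stdSimplex ℝ S ∧ π ᵥ* P = π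

/-- `H(P | π)`, the conditional entropy `H(Y | X)` in bits of a pair `(X, Y)` with
`Pr{X = i, Y = j} = π i * P i j`. -/
noncomputable def condEntropy {S : Type*} [Fintype S] (P : Matrix S S ℝ) (π : S → ℝ) : ℝ :=
  -∑ i, ∑ j, π i * P i j * Real.logb 2 (P i j)

/-- The data sequence `Xⁿ = [X⁽¹⁾, …, X⁽ⁿ⁾]`. -/
def block {Ω S : Type*} (X : ℕ → Ω → S) (n : ℕ) (ω : Ω) : Fin n → S := fun i => X i ω

/-- The rate `R` is achievable for (losslessly) encoding the source `X`, with arbitrary encoders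
into the integers of `[1, 2^(nR)]` and arbitrary decoders. -/
def Achievable {Ω S : Type*} [MeasurableSpace Ω] (μ : MeasureTheory.Measure Ω) (X : ℕ → Ω → S)
    (R : ℝ) : Prop :=
  ∀ ε : ℝ, 0 < ε → ∃ N₀ : ℕ, ∀ n : ℕ, N₀ < n →
    ∃ (φ : (Fin n → S) → Fin ⌊(2 : ℝ) ^ ((n : ℝ) * R)⌋₊)
      (ψ : Fin ⌊(2 : ℝ) ^ ((n : ℝ) * R)⌋₊ → (Fin n → S)),
      μ.real {ω | ψ (φ (block X n ω)) ≠ block X n ω} < ε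

/-- After each letter is mapped into `F` by `Φ`, some (left) linear encoder `z ↦ A z` from `F^n` to
`F^k` and some decoder recover the first `n` letters with error probability less than `ε`. -/
def LinearlyEncodable {Ω S F : Type*} [MeasurableSpace Ω] [Ring F]
    (μ : MeasureTheory.Measure Ω) (X : ℕ → Ω → S) (Φ : S → F) (n k : ℕ) (ε : ℝ) : Prop :=
  ∃ (A : Matrix (Fin k) (Fin n) F) (ψ : (Fin k → F) → (Fin n → S)),
    μ.real {ω | ψ (A *ᵥ (Φ ∘ block X n ω)) ≠ block X n ω} < ε

/-- The rate `R` is achievable for the source `X` with linear coding over the finite ring `F`, the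
letters being mapped into `F` by `Φ`: the codomain `F^k` of the encoder has at most `2^(nR)`
elements. -/
def LinearlyAchievable {Ω S F : Type*} [MeasurableSpace Ω] [Ring F] [Fintype F]
    (μ : MeasureTheory.Measure Ω) (X : ℕ → Ω → S) (Φ : S → F) (R : ℝ) : Prop :=
  ∀ ε : ℝ, 0 < ε → ∃ N₀ : ℕ, ∀ n : ℕ, N₀ < n →
    ∃ k : ℕ, (Fintype.card F : ℝ) ^ k ≤ (2 : ℝ) ^ ((n : ℝ) * R) ∧
      LinearlyEncodable μ X Φ n k ε

end MarkovCoding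

/-!
The rate threshold comes from the asymptotic equipartition property, which for an irreducible chain
needs neither stationarity nor aperiodicity.

Writing `f i j = -log₂ (P i j)`, whose mean under `π i * P i j` is the entropy `H`, the Poisson
equation `h - P h = g` with `g i = ∑ j, P i j * f i j - H` is solvable (`exists_poisson`): by the
maximum principle the kernel of `I - P` consists of the constants, so its range is the whole
hyperplane orthogonal to `π`. Hence the sum of `f - H` along a path is a martingale with bounded
increments plus a bounded boundary term, and Chebyshev's inequality gives the weak law of large
numbers for any initial law (`weak_law`). The result is a typical set of at most about `2 ^ (n H)`
words, of probability close to `1`, each of whose words has probability at most about `2 ^ (-n H)`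
(`exists_typicalSet`).

Achievability is a random coding argument. A uniformly random `k × n` matrix over a field maps two
given distinct words to the same syndrome with probability `|F| ^ (-k)`
(`card_mulVec_eq_zero_mul_le`), so some matrix separates the transmitted word from the other typical
words except with probability `|T| / |F| ^ k` (`exists_linear_code`), which tends to zero when
`|F| ^ k ≥ 2 ^ (n R)` and `R > H`.

Conversely a code with `2 ^ (n R)` codewords decodes at most `2 ^ (n R)` words correctly, and for
`R < H` their typical part has vanishing probability (`IsMarkovChain.not_achievable`).
-/

open scoped Matrix

namespace MarkovCoding

open Finset Filter Topology

/-! ### The Poisson equation of an irreducible chain -/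

/-- Maximum principle: at a maximum of `h` the value `h i` is an average of values `≤ h i`, so it
propagates along the edges of the transition graph. -/
lemma eq_const_of_mulVec_eq {S : Type*} [Fintype S] {P : Matrix S S ℝ}
    (hrow : ∀ i, ∑ j, P i j = 1) (hP : P.IsIrreducible) {h : S → ℝ} (hh : P *ᵥ h = h) (i j : S) :
    h i = h j := by
  classical
  have : Nonempty S := ⟨i⟩
  obtain ⟨a, -, ha⟩ := exists_max_image (univ : Finset S) h univ_nonempty
  have step : ∀ b c, h b = h a → 0 < P b c → h c = h a := by
    intro b c hb hbc
    have h0 : ∑ c, P b c * (h a - h c) = 0 := by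
      have h1 : ∑ c, P b c * h c = h b := congrFun hh b
      simp only [mul_sub, sum_sub_distrib, ← sum_mul, hrow, h1, hb, one_mul, sub_self]
    have h2 := (sum_eq_zero_iff_of_nonneg
      (fun c _ => mul_nonneg (hP.nonneg b c) (sub_nonneg.2 (ha c (mem_univ c))))).1 h0 c
      (mem_univ c)
    rcases mul_eq_zero.1 h2 with h3 | h3
    · exact absurd h3 hbc.ne'
    · linarith
  let := P.toQuiver
  have path : ∀ b, Quiver.Path a b → h b = h a := by
    intro b p
    induction p with
    | nil => rfl
    | cons _ e ih => exact step _ _ ih e.down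
  have all : ∀ b, h b = h a := fun b => path b (hP.connected a b).choose
  rw [all i, all j]

/-- Solvability of the Poisson equation: the range of `I - P` lies in the hyperplane `π ⬝ᵥ g = 0`
and, its kernel being the constants, has the same dimension. -/
lemma exists_poisson {S : Type*} [Fintype S] {P : Matrix S S ℝ} {π : S → ℝ}
    (hrow : ∀ i, ∑ j, P i j = 1) (hP : P.IsIrreducible) (hπ : IsInvariantDistribution π P)
    {g : S → ℝ} (hg : π ⬝ᵥ g = 0) : ∃ h : S → ℝ, ∀ i, h i - ∑ j, P i j * h j = g i := by
  classical
  let T : (S → ℝ) →ₗ[ℝ] (S → ℝ) := LinearMap.id - P.mulVecLin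
  let ℓ : (S → ℝ) →ₗ[ℝ] ℝ := dotProductBilin ℝ ℝ π
  have hℓ : ∀ v, ℓ v = π ⬝ᵥ v := fun v => rfl
  have hle : LinearMap.range T ≤ LinearMap.ker ℓ := by
    rintro _ ⟨v, rfl⟩
    simp [T, hℓ, dotProduct_sub, Matrix.dotProduct_mulVec, hπ.2]
  have hsum : π ⬝ᵥ (fun _ => (1 : ℝ)) = 1 := by simpa [dotProduct] using hπ.1.2
  have hker : LinearMap.ker T ≤ Submodule.span ℝ {fun _ : S => (1 : ℝ)} := by
    intro v hv
    have hv' : P *ᵥ v = v := (sub_eq_zero.1 (by simpa [T] using hv)).symm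
    rw [Submodule.mem_span_singleton]
    refine ⟨π ⬝ᵥ v, funext fun i => ?_⟩
    have : v = v i • (fun _ => (1 : ℝ)) := funext fun j => by
      simpa using eq_const_of_mulVec_eq hrow hP hv' j i
    conv_lhs => rw [this]
    rw [dotProduct_smul, hsum]
    simp
  have h1 : Module.finrank ℝ (LinearMap.ker T) ≤ 1 :=
    (Submodule.finrank_mono hker).trans ((finrank_span_le_card _).trans (by simp))
  have h2 := LinearMap.finrank_range_add_finrank_ker T
  have h3 := LinearMap.finrank_range_add_finrank_ker ℓ
  have h4 : LinearMap.range ℓ = ⊤ :=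
    LinearMap.range_eq_top.2 fun c => ⟨fun _ => c, by
      rw [hℓ]; simpa [dotProduct, ← sum_mul] using by rw [hπ.1.2, one_mul]⟩
  rw [h4, finrank_top, Module.finrank_self] at h3
  have heq := Submodule.eq_of_le_of_finrank_le hle (by omega)
  have hg' : g ∈ LinearMap.range T := by rw [heq]; exact hg
  obtain ⟨h, hh⟩ := hg'
  exact ⟨h, fun i => congrFun hh i⟩

/-! ### The weak law of large numbers for path functionals -/

/-- The product of the transition probabilities along the path `x`. -/
def pathWeight {S : Type*} (P : Matrix S S ℝ) {m : ℕ} (x : Fin (m + 1) → S) : ℝ :=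
  ∏ t : Fin m, P (x t.castSucc) (x t.succ)

/-- The sum of `f` over the transitions made by the path `x`. -/
def pathSum {S : Type*} (f : S → S → ℝ) {m : ℕ} (x : Fin (m + 1) → S) : ℝ :=
  ∑ t : Fin m, f (x t.castSucc) (x t.succ)

lemma pathWeight_snoc {S : Type*} (P : Matrix S S ℝ) {m : ℕ} (x : Fin (m + 1) → S) (j : S) :
    pathWeight P (Fin.snoc x j : Fin (m + 2) → S) = pathWeight P x * P (x (Fin.last m)) j := by
  simp only [pathWeight, Fin.prod_univ_castSucc, Fin.succ_castSucc, Fin.succ_last,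
    Fin.snoc_castSucc (α := fun _ => S), Fin.snoc_last (α := fun _ => S)]

lemma pathSum_snoc {S : Type*} (f : S → S → ℝ) {m : ℕ} (x : Fin (m + 1) → S) (j : S) :
    pathSum f (Fin.snoc x j : Fin (m + 2) → S) = pathSum f x + f (x (Fin.last m)) j := by
  simp only [pathSum, Fin.sum_univ_castSucc, Fin.succ_castSucc, Fin.succ_last,
    Fin.snoc_castSucc (α := fun _ => S), Fin.snoc_last (α := fun _ => S)]

lemma snoc_zero {S : Type*} {m : ℕ} (x : Fin (m + 1) → S) (j : S) :
    (Fin.snoc x j : Fin (m + 2) → S) 0 = x 0 :=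
  Fin.snoc_castSucc (α := fun _ => S) j x 0

lemma sum_snoc {S : Type*} [Fintype S] {m : ℕ} (g : (Fin (m + 2) → S) → ℝ) :
    ∑ x, g x = ∑ x : Fin (m + 1) → S, ∑ j, g (Fin.snoc x j) := by
  rw [← (Fin.snocEquiv (fun _ : Fin (m + 2) => S)).sum_comp, Fintype.sum_prod_type_right]
  rfl

lemma pathWeight_nonneg {S : Type*} {P : Matrix S S ℝ} (hP : ∀ i j, 0 ≤ P i j) {m : ℕ}
    (x : Fin (m + 1) → S) : 0 ≤ pathWeight P x :=
  prod_nonneg fun _ _ => hP _ _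

lemma sum_mul_pathWeight {S : Type*} [Fintype S] {P : Matrix S S ℝ}
    (hrow : ∀ i, ∑ j, P i j = 1) (ν : S → ℝ) (m : ℕ) :
    ∑ x : Fin (m + 1) → S, ν (x 0) * pathWeight P x = ∑ i, ν i := by
  induction m with
  | zero =>
    rw [← (Equiv.funUnique (Fin 1) S).symm.sum_comp]
    simp [pathWeight]
  | succ m ih =>
    rw [sum_snoc, ← ih]
    refine sum_congr rfl fun x _ => ?_
    simp_rw [pathWeight_snoc, snoc_zero, ← mul_assoc, ← mul_sum, hrow, mul_one]

/-- When every row average of `d` vanishes, `pathSum d` is a martingale with orthogonal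
increments, so that its second moment grows at most linearly. -/
lemma sum_pathSum_sq_le {S : Type*} [Fintype S] {P : Matrix S S ℝ} (hP : ∀ i j, 0 ≤ P i j)
    (hrow : ∀ i, ∑ j, P i j = 1) {ν : S → ℝ} (hν : ∀ i, 0 ≤ ν i) (hν1 : ∑ i, ν i = 1)
    {d : S → S → ℝ} (hd : ∀ i, ∑ j, P i j * d i j = 0) {C : ℝ} (hC : ∀ i j, d i j ^ 2 ≤ C)
    (m : ℕ) :
    ∑ x : Fin (m + 1) → S, ν (x 0) * pathWeight P x * pathSum d x ^ 2 ≤ m * C := by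
  induction m with
  | zero => simp [pathSum]
  | succ m ih =>
    rw [sum_snoc]
    have key : ∀ x : Fin (m + 1) → S,
        ∑ j, ν ((Fin.snoc x j : Fin (m + 2) → S) 0) *
          pathWeight P (Fin.snoc x j : Fin (m + 2) → S) *
            pathSum d (Fin.snoc x j : Fin (m + 2) → S) ^ 2 ≤
        ν (x 0) * pathWeight P x * pathSum d x ^ 2 + ν (x 0) * pathWeight P x * C := by
      intro x
      have hq : 0 ≤ ν (x 0) * pathWeight P x := mul_nonneg (hν _) (pathWeight_nonneg hP x)
      simp_rw [pathWeight_snoc, pathSum_snoc, snoc_zero]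
      set i := x (Fin.last m)
      have e : ∀ j, ν (x 0) * (pathWeight P x * P i j) * (pathSum d x + d i j) ^ 2 =
          ν (x 0) * pathWeight P x * (pathSum d x ^ 2 * P i j
            + 2 * pathSum d x * (P i j * d i j) + P i j * d i j ^ 2) := fun j => by ring
      simp_rw [e, ← mul_sum, sum_add_distrib, ← mul_sum, hrow, hd]
      have : ∑ j, P i j * d i j ^ 2 ≤ C := by
        calc _ ≤ ∑ j, P i j * C :=
              sum_le_sum fun j _ => mul_le_mul_of_nonneg_left (hC i j) (hP i j)
          _ = C := by rw [← sum_mul, hrow, one_mul]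
      rw [← mul_add]
      exact mul_le_mul_of_nonneg_left (by linarith) hq
    refine (sum_le_sum fun x _ => key x).trans ?_
    rw [sum_add_distrib, ← sum_mul, sum_mul_pathWeight hrow, hν1]
    push_cast
    linarith

open Classical in
/-- The weak law of large numbers for an irreducible chain with an arbitrary initial law `ν`. With
`h` a solution of the Poisson equation, `pathSum f x - m * f̄` is, up to the bounded boundary term
`h (x 0) - h (x m)`, a martingale, to which Chebyshev's inequality applies; periodicity plays no
role. -/
lemma weak_law {S : Type*} [Fintype S] {P : Matrix S S ℝ} {π : S → ℝ}
    (hrow : ∀ i, ∑ j, P i j = 1) (hP : P.IsIrreducible) (hπ : IsInvariantDistribution π P)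
    {ν : S → ℝ} (hν : ∀ i, 0 ≤ ν i) (hν1 : ∑ i, ν i = 1) (f : S → S → ℝ) {δ : ℝ} (hδ : 0 < δ) :
    Tendsto (fun m : ℕ => ∑ x : Fin (m + 1) → S with
        δ * m < |pathSum f x - m * ∑ i, ∑ j, π i * P i j * f i j|,
      ν (x 0) * pathWeight P x) atTop (𝓝 0) := by
  set c := ∑ i, ∑ j, π i * P i j * f i j with hc
  obtain ⟨h, hh⟩ := exists_poisson hrow hP hπ (g := fun i => ∑ j, P i j * f i j - c) (by
    have e1 : ∑ i, π i * ∑ j, P i j * f i j = c := by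
      simp_rw [hc, mul_sum, mul_assoc]
    simp only [dotProduct, mul_sub, sum_sub_distrib, ← sum_mul, e1, hπ.1.2]
    ring)
  let d : S → S → ℝ := fun i j => f i j - c + h j - h i
  have hd : ∀ i, ∑ j, P i j * d i j = 0 := by
    intro i
    have e : ∀ j, P i j * d i j = P i j * f i j + P i j * h j - P i j * (c + h i) := fun j => by
      simp only [d]; ring
    simp_rw [e, sum_sub_distrib, sum_add_distrib, ← sum_mul, hrow]
    linarith [hh i]
  have hpath : ∀ (m : ℕ) (x : Fin (m + 1) → S),
      pathSum f x - m * c = pathSum d x + h (x 0) - h (x (Fin.last m)) := by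
    intro m
    induction m with
    | zero => intro x; simp [pathSum]
    | succ m ih =>
      intro x
      rw [← Fin.snoc_init_self (α := fun _ => S) x]
      generalize Fin.init x = y
      generalize x (Fin.last (m + 1)) = j
      rw [pathSum_snoc, pathSum_snoc, snoc_zero, Fin.snoc_last]
      have := ih y
      simp only [d] at this ⊢
      push_cast
      linarith
  let C : ℝ := ∑ i, ∑ j, d i j ^ 2
  have hC : ∀ i j, d i j ^ 2 ≤ C := fun i j =>
    (single_le_sum (f := fun j => d i j ^ 2) (fun j _ => sq_nonneg _) (mem_univ j)).trans
      (single_le_sum (f := fun i => ∑ j, d i j ^ 2)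
        (fun i _ => sum_nonneg fun j _ => sq_nonneg _) (mem_univ i))
  let B : ℝ := ∑ i, |h i|
  have hB : ∀ i, |h i| ≤ B := fun i => single_le_sum (fun i _ => abs_nonneg (h i)) (mem_univ i)
  -- for `m ≥ 4 * B / δ` the boundary term is at most `δ * m / 2`
  have hbound : ∀ᶠ m : ℕ in atTop, ∑ x : Fin (m + 1) → S with δ * m < |pathSum f x - m * c|,
      ν (x 0) * pathWeight P x ≤ (4 * C / δ ^ 2) / m := by
    filter_upwards [eventually_ge_atTop ⌈4 * B / δ⌉₊, eventually_gt_atTop 0] with m hm hm0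
    have hm' : 4 * B ≤ δ * m := by
      have := Nat.ceil_le.1 hm
      rw [div_le_iff₀ hδ] at this
      linarith
    have hm0' : (0 : ℝ) < m := by exact_mod_cast hm0
    have h1 : (δ * m / 2) ^ 2 * ∑ x : Fin (m + 1) → S with δ * m < |pathSum f x - m * c|,
        ν (x 0) * pathWeight P x ≤ m * C := by
      refine le_trans ?_ (sum_pathSum_sq_le hP.nonneg hrow hν hν1 hd hC m)
      rw [mul_sum]
      calc _ ≤ ∑ x : Fin (m + 1) → S with δ * m < |pathSum f x - m * c|,
              ν (x 0) * pathWeight P x * pathSum d x ^ 2 := by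
            refine sum_le_sum fun x hx => ?_
            rw [mul_comm]
            refine mul_le_mul_of_nonneg_left ?_ (mul_nonneg (hν _) (pathWeight_nonneg hP.nonneg x))
            rw [mem_filter, hpath] at hx
            rw [← sq_abs (pathSum d x)]
            have h3 : |pathSum d x + h (x 0) - h (x (Fin.last m))| ≤ |pathSum d x| + B + B :=
              (abs_sub _ _).trans (add_le_add ((abs_add_le _ _).trans
                (add_le_add le_rfl (hB _))) (hB _))
            refine pow_le_pow_left₀ (by positivity) ?_ 2
            linarith [hx.2]
        _ ≤ _ := sum_le_sum_of_subset_of_nonneg (filter_subset _ _) fun x _ _ =>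
            mul_nonneg (mul_nonneg (hν _) (pathWeight_nonneg hP.nonneg x)) (sq_nonneg _)
    rw [div_div, le_div_iff₀ (by positivity)]
    have h2 : m * ((∑ x : Fin (m + 1) → S with δ * m < |pathSum f x - m * c|,
        ν (x 0) * pathWeight P x) * (δ ^ 2 * m)) ≤ m * (4 * C) := by linarith
    exact le_of_mul_le_mul_left h2 hm0'
  refine tendsto_of_tendsto_of_tendsto_of_le_of_le' tendsto_const_nhds
    (tendsto_const_div_atTop_nhds_zero_nat (4 * C / δ ^ 2)) (Eventually.of_forall fun m =>
      sum_nonneg fun x _ => mul_nonneg (hν _) (pathWeight_nonneg hP.nonneg x)) hbound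

/-! ### Random linear codes -/

/-- For `z ≠ 0` at most a fraction `|F| ^ (-k)` of the `k × n` matrices annihilate `z`: if `z j ≠ 0`,
changing the column `j` by `y` changes `A *ᵥ z` by `z j • y`, so the `|F| ^ k` translates of the
annihilating matrices obtained in this way are disjoint. -/
lemma card_mulVec_eq_zero_mul_le {F : Type*} [Field F] [Fintype F] [DecidableEq F] {n k : ℕ}
    {z : Fin n → F} (hz : z ≠ 0) :
    #{A : Matrix (Fin k) (Fin n) F | A *ᵥ z = 0} * Fintype.card F ^ k ≤
      Fintype.card (Matrix (Fin k) (Fin n) F) := by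
  obtain ⟨j, hj⟩ := Function.ne_iff.1 hz
  have hcard : Fintype.card F ^ k = #(univ : Finset (Fin k → F)) := by simp
  rw [hcard, ← card_product, ← card_univ]
  refine card_le_card_of_injOn
    (fun p => p.1 + Matrix.vecMulVec p.2 (Pi.single j 1)) (fun _ _ => mem_coe.2 (mem_univ _)) ?_
  rintro ⟨A, y⟩ hA ⟨B, w⟩ hB h
  simp only [coe_product, Set.mem_prod, mem_coe, mem_filter, mem_univ, true_and, and_true] at hA hB
  simp only at h
  have h1 := congrArg (· *ᵥ z) h
  simp only [Matrix.add_mulVec, hA, hB, zero_add, Matrix.vecMulVec_mulVec,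
    single_one_dotProduct] at h1
  have hyw : y = w := funext fun i => by
    have := congrFun h1 i
    simpa using mul_right_cancel₀ (by simpa using hj) (by simpa using this)
  subst hyw
  simpa using h

open Classical in
/-- Random coding: the collision probability on `T`, averaged over all matrices, is at most
`|T| / |F| ^ k`, so some matrix does at least as well. -/
lemma exists_linear_code {S F : Type*} [Fintype S] [Field F] [Fintype F] {n : ℕ}
    {Φ : S → F} (hΦ : Function.Injective Φ) {q : (Fin n → S) → ℝ} (hq : ∀ x, 0 ≤ q x)
    (hq1 : ∑ x, q x ≤ 1) (hS : Nonempty S) (T : Finset (Fin n → S)) (k : ℕ) :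
    ∃ (A : Matrix (Fin k) (Fin n) F) (ψ : (Fin k → F) → (Fin n → S)),
      ∑ x with ψ (A *ᵥ (Φ ∘ x)) ≠ x, q x ≤
        ∑ x with x ∉ T, q x + (#T : ℝ) / (Fintype.card F : ℝ) ^ k := by
  let M := Matrix (Fin k) (Fin n) F
  have hF : (0 : ℝ) < (Fintype.card F : ℝ) ^ k := by
    have : 0 < Fintype.card F := Fintype.card_pos
    positivity
  let K : M → Finset (Fin n → S) := fun A =>
    {x ∈ T | ∃ y ∈ T, y ≠ x ∧ A *ᵥ (Φ ∘ y) = A *ᵥ (Φ ∘ x)}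
  have hpair : ∀ x y : Fin n → S, y ≠ x →
      (#{A : M | A *ᵥ (Φ ∘ y) = A *ᵥ (Φ ∘ x)} : ℝ) ≤
        (Fintype.card M : ℝ) / (Fintype.card F : ℝ) ^ k := by
    intro x y hxy
    have hz : Φ ∘ y - Φ ∘ x ≠ 0 := fun h => hxy (hΦ.comp_left (sub_eq_zero.1 h))
    have h1 := card_mulVec_eq_zero_mul_le (k := k) hz
    simp_rw [Matrix.mulVec_sub, sub_eq_zero] at h1
    rw [le_div_iff₀ hF]
    exact_mod_cast h1
  have havg : ∑ A : M, ∑ x ∈ K A, q x ≤ ∑ _A : M, (#T : ℝ) / (Fintype.card F : ℝ) ^ k := by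
    calc ∑ A : M, ∑ x ∈ K A, q x
        ≤ ∑ A : M, ∑ x, ∑ y ∈ T, if y ≠ x ∧ A *ᵥ (Φ ∘ y) = A *ᵥ (Φ ∘ x) then q x else 0 := by
          refine sum_le_sum fun A _ => ?_
          have hnn : ∀ x y, (0 : ℝ) ≤
              if y ≠ x ∧ A *ᵥ (Φ ∘ y) = A *ᵥ (Φ ∘ x) then q x else 0 := fun x y => by
            split_ifs <;> simp [hq]
          refine (sum_le_sum fun x hx => ?_).trans
            (sum_le_sum_of_subset_of_nonneg (subset_univ (K A)) fun x _ _ =>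
              sum_nonneg fun y _ => hnn x y)
          obtain ⟨y, hy, hyx⟩ := (mem_filter.1 hx).2
          refine le_trans ?_ (single_le_sum (fun y _ => hnn x y) hy)
          simp only [if_pos hyx, le_refl]
      _ = ∑ x, ∑ y ∈ T, ∑ A : M,
            if y ≠ x ∧ A *ᵥ (Φ ∘ y) = A *ᵥ (Φ ∘ x) then q x else 0 := by
          rw [sum_comm]
          exact sum_congr rfl fun x _ => sum_comm
      _ ≤ ∑ x, ∑ _y ∈ T, q x * ((Fintype.card M : ℝ) / (Fintype.card F : ℝ) ^ k) := by
          refine sum_le_sum fun x _ => sum_le_sum fun y _ => ?_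
          by_cases hxy : y = x
          · simp only [hxy, ne_eq, not_true_eq_false, false_and, if_false, sum_const_zero]
            exact mul_nonneg (hq x) (by positivity)
          · simp only [ne_eq, hxy, not_false_eq_true, true_and]
            rw [← sum_filter, sum_const, nsmul_eq_mul, mul_comm]
            exact mul_le_mul_of_nonneg_left (hpair x y hxy) (hq x)
      _ = (∑ x, q x) * (#T * ((Fintype.card M : ℝ) / (Fintype.card F : ℝ) ^ k)) := by
          rw [sum_mul]
          exact sum_congr rfl fun x _ => by rw [sum_const, nsmul_eq_mul]; ring
      _ ≤ 1 * (#T * ((Fintype.card M : ℝ) / (Fintype.card F : ℝ) ^ k)) :=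
          mul_le_mul_of_nonneg_right hq1 (by positivity)
      _ = ∑ _A : M, (#T : ℝ) / (Fintype.card F : ℝ) ^ k := by
          rw [sum_const, nsmul_eq_mul, card_univ]; ring
  obtain ⟨A, -, hA⟩ := exists_le_of_sum_le univ_nonempty havg
  -- decode to any word of `T` with the received syndrome
  let ψ : (Fin k → F) → (Fin n → S) := fun s =>
    if h : ∃ y ∈ T, A *ᵥ (Φ ∘ y) = s then h.choose else fun _ => hS.some
  refine ⟨A, ψ, ?_⟩
  have hsub : ({x | ψ (A *ᵥ (Φ ∘ x)) ≠ x} : Finset (Fin n → S)) ⊆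
      ({x | x ∉ T} : Finset (Fin n → S)) ∪ K A := by
    intro x hx
    rw [mem_filter] at hx
    by_cases hxT : x ∈ T
    · have hex : ∃ y ∈ T, A *ᵥ (Φ ∘ y) = A *ᵥ (Φ ∘ x) := ⟨x, hxT, rfl⟩
      have hψ : ψ (A *ᵥ (Φ ∘ x)) = hex.choose := dif_pos hex
      refine mem_union_right _ (mem_filter.2 ⟨hxT, hex.choose, hex.choose_spec.1, ?_,
        hex.choose_spec.2⟩)
      rw [← hψ]
      exact hx.2
    · exact mem_union_left _ (mem_filter.2 ⟨mem_univ x, hxT⟩)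
  calc _ ≤ ∑ x ∈ ({x | x ∉ T} : Finset (Fin n → S)) ∪ K A, q x :=
        sum_le_sum_of_subset_of_nonneg hsub fun x _ _ => hq x
    _ ≤ ∑ x with x ∉ T, q x + ∑ x ∈ K A, q x := by
        rw [← sum_union_inter]
        exact le_add_of_nonneg_right (sum_nonneg fun x _ => hq x)
    _ ≤ _ := by gcongr

/-! ### The law of a block of the chain -/

section Block

open MeasureTheory ProbabilityTheory

lemma IsMarkovChain.measurable_block {Ω S : Type*} [MeasurableSpace Ω] [Fintype S]
    [MeasurableSpace S] {μ : Measure Ω} {X : ℕ → Ω → S} {P : Matrix S S ℝ}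
    (hX : IsMarkovChain μ X P) (n : ℕ) :
    Measurable (block X n) :=
  measurable_pi_lambda _ fun i => hX.measurable i

variable {Ω S : Type*} [MeasurableSpace Ω] [Fintype S] [MeasurableSpace S]
  [DiscreteMeasurableSpace S] {μ : Measure Ω} [IsProbabilityMeasure μ]
  {X : ℕ → Ω → S} {P : Matrix S S ℝ}

lemma IsMarkovChain.measureReal_block_mem (hX : IsMarkovChain μ X P) (n : ℕ)
    (p : (Fin n → S) → Prop) [DecidablePred p] :
    μ.real {ω | p (block X n ω)} = ∑ x with p x, μ.real {ω | block X n ω = x} := by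
  have h : {ω | p (block X n ω)} =
      ⋃ x ∈ ({x | p x} : Finset (Fin n → S)), {ω | block X n ω = x} := by
    ext ω; simp
  rw [h, measureReal_biUnion_finset]
  · intro x _ y _ hxy
    exact Set.disjoint_left.2 fun ω h1 h2 => hxy (h1.symm.trans h2)
  · intro x _
    exact hX.measurable_block n (measurableSet_singleton x)

lemma IsMarkovChain.measureReal_block_snoc (hX : IsMarkovChain μ X P) {m : ℕ}
    (x : Fin (m + 1) → S) (j : S) :
    μ.real {ω | block X (m + 2) ω = Fin.snoc x j} =
      μ.real {ω | block X (m + 1) ω = x} * P (x (Fin.last m)) j := by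
  let y : ℕ → S := fun i => if h : i < m + 1 then x ⟨i, h⟩ else x 0
  have hpast : {ω | ∀ i ≤ m, X i ω = y i} = {ω | block X (m + 1) ω = x} := by
    ext ω
    simp only [Set.mem_ofPred_eq, funext_iff, block, Fin.forall_iff, Nat.lt_succ_iff]
    refine forall₂_congr fun i hi => ?_
    simp [y, hi]
  have hnext : {ω | block X (m + 2) ω = Fin.snoc x j} =
      {ω | block X (m + 1) ω = x} ∩ {ω | X (m + 1) ω = j} := by
    ext ω
    simp only [Set.mem_ofPred_eq, Set.mem_inter_iff]
    rw [funext_iff, Fin.forall_fin_succ']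
    simp only [Fin.snoc_castSucc (α := fun _ => S), Fin.snoc_last (α := fun _ => S)]
    rw [← funext_iff]
    rfl
  have hmeas : MeasurableSet {ω | block X (m + 1) ω = x} :=
    hX.measurable_block (m + 1) (measurableSet_singleton x)
  rw [hnext]
  by_cases h0 : μ {ω | block X (m + 1) ω = x} = 0
  · have h1 : μ.real {ω | block X (m + 1) ω = x} = 0 := by simp [measureReal_def, h0]
    rw [h1, zero_mul]
    exact measureReal_mono_null Set.inter_subset_left h1
  · have ht := hX.transition m y j (by rwa [hpast])
    rw [hpast] at ht
    have hy : y m = x (Fin.last m) := by simp [y, Fin.last]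
    rw [← hy, ← ht, mul_comm, measureReal_def, measureReal_def, measureReal_def,
      ← ENNReal.toReal_mul, cond_mul_eq_inter hmeas]

end Block

open MeasureTheory ProbabilityTheory

/-! ### Asymptotic equipartition -/

section Equipartition

variable {Ω S : Type*} [MeasurableSpace Ω] [Fintype S] [MeasurableSpace S]
  [DiscreteMeasurableSpace S] {μ : Measure Ω} [IsProbabilityMeasure μ]
  {X : ℕ → Ω → S} {P : Matrix S S ℝ} {π : S → ℝ}

lemma IsMarkovChain.measureReal_block_eq (hX : IsMarkovChain μ X P) (m : ℕ)
    (x : Fin (m + 1) → S) :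
    μ.real {ω | block X (m + 1) ω = x} = μ.real {ω | X 0 ω = x 0} * pathWeight P x := by
  induction m with
  | zero =>
    have : {ω | block X 1 ω = x} = {ω | X 0 ω = x 0} := by
      ext ω
      simp [funext_iff, block]
    simp [pathWeight, this]
  | succ m ih =>
    rw [← Fin.snoc_init_self (α := fun _ => S) x, hX.measureReal_block_snoc, ih, pathWeight_snoc,
      snoc_zero, mul_assoc]

lemma pathWeight_eq_rpow {S : Type*} {P : Matrix S S ℝ} (hP : ∀ i j, 0 ≤ P i j) {m : ℕ}
    {x : Fin (m + 1) → S} (hx : pathWeight P x ≠ 0) :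
    pathWeight P x = 2 ^ (-pathSum (fun i j => -Real.logb 2 (P i j)) x) := by
  have h : -pathSum (fun i j => -Real.logb 2 (P i j)) x = Real.logb 2 (pathWeight P x) := by
    rw [pathWeight, Real.logb_prod _ _ (fun t ht => prod_ne_zero_iff.1 hx t ht)]
    simp [pathSum]
  rw [h, Real.rpow_logb (by norm_num) (by norm_num)
    (lt_of_le_of_ne (pathWeight_nonneg hP x) hx.symm)]

lemma condEntropy_nonneg {S : Type*} [Fintype S] {P : Matrix S S ℝ} {π : S → ℝ}
    (hP : ∀ i j, 0 ≤ P i j) (hrow : ∀ i, ∑ j, P i j = 1) (hπ : IsInvariantDistribution π P) :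
    0 ≤ condEntropy P π := by
  rw [condEntropy, neg_nonneg]
  refine sum_nonpos fun i _ => sum_nonpos fun j _ => mul_nonpos_of_nonneg_of_nonpos
    (mul_nonneg (hπ.1.1 i) (hP i j)) (Real.logb_nonpos (by norm_num) (hP i j) ?_)
  rw [← hrow i]
  exact single_le_sum (fun j _ => hP i j) (mem_univ j)

/-- Asymptotic equipartition. The typical set consists of the paths of positive weight along which
the average of `-log₂ (P i j)` is within `δ` of the entropy; the cardinality bound holds because
the path weights add up to `|S|`, whatever the initial law. -/
lemma exists_typicalSet (hX : IsMarkovChain μ X P) (hP : P.IsIrreducible)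
    (hπ : IsInvariantDistribution π P) {δ : ℝ} (hδ : 0 < δ) :
    ∃ T : ∀ m : ℕ, Finset (Fin (m + 1) → S),
      Tendsto (fun m => μ.real {ω | block X (m + 1) ω ∉ T m}) atTop (𝓝 0) ∧
      (∀ m : ℕ, (#(T m) : ℝ) ≤ Fintype.card S * 2 ^ (m * (condEntropy P π + δ))) ∧
      ∀ (m : ℕ), ∀ x ∈ T m,
        μ.real {ω | block X (m + 1) ω = x} ≤ 2 ^ (-(m * (condEntropy P π - δ))) := by
  classical
  let f : S → S → ℝ := fun i j => -Real.logb 2 (P i j)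
  have hf : ∑ i, ∑ j, π i * P i j * f i j = condEntropy P π := by
    simp [f, condEntropy]
  set H := condEntropy P π
  have hν1 : ∑ i, μ.real {ω | X 0 ω = i} = 1 := by
    have h := sum_measureReal_preimage_singleton (μ := μ) (univ : Finset S) (f := X 0)
      (fun y _ => hX.measurable 0 (measurableSet_singleton y))
    rw [coe_univ, Set.preimage_univ, probReal_univ] at h
    exact h
  have hlaw := weak_law hX.row_sum hP hπ (ν := fun i => μ.real {ω | X 0 ω = i})
    (fun i => measureReal_nonneg) hν1 f hδ
  simp_rw [hf, ← hX.measureReal_block_eq] at hlaw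
  refine ⟨fun m => {x | pathWeight P x ≠ 0 ∧ |pathSum f x - m * H| ≤ δ * m}, ?_, ?_, ?_⟩
  · refine squeeze_zero (fun m => measureReal_nonneg) (fun m => ?_) hlaw
    rw [hX.measureReal_block_mem (m + 1) (fun x => x ∉ _), ← sum_filter_ne_zero]
    refine sum_le_sum_of_subset_of_nonneg (fun x hx => ?_) fun x _ _ => measureReal_nonneg
    simp only [mem_filter, mem_univ, true_and, not_and, not_le] at hx ⊢
    refine hx.1 fun h0 => hx.2 ?_
    rw [hX.measureReal_block_eq, h0, mul_zero]
  · intro m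
    have h1 : ∑ x : Fin (m + 1) → S, pathWeight P x = Fintype.card S := by
      have := sum_mul_pathWeight hX.row_sum (fun _ => 1) m
      simpa using this
    have h2 : ∀ x ∈ ({x | pathWeight P x ≠ 0 ∧ |pathSum f x - m * H| ≤ δ * m} :
        Finset (Fin (m + 1) → S)), (2 : ℝ) ^ (-(m * (H + δ))) ≤ pathWeight P x := by
      intro x hx
      rw [mem_filter] at hx
      rw [pathWeight_eq_rpow hX.nonneg hx.2.1]
      refine Real.rpow_le_rpow_of_exponent_le (by norm_num) ?_
      have := (abs_le.1 hx.2.2).2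
      simp only [f] at this
      linarith
    have h3 := (card_nsmul_le_sum _ _ _ h2).trans
      (sum_le_sum_of_subset_of_nonneg (subset_univ _)
        fun x _ _ => pathWeight_nonneg hX.nonneg x)
    rw [h1, nsmul_eq_mul, Real.rpow_neg (by norm_num), ← div_eq_mul_inv,
      div_le_iff₀ (by positivity)] at h3
    exact h3
  · intro m x hx
    rw [mem_filter] at hx
    rw [hX.measureReal_block_eq]
    refine (mul_le_of_le_one_left (pathWeight_nonneg hX.nonneg x) measureReal_le_one).trans ?_
    rw [pathWeight_eq_rpow hX.nonneg hx.2.1]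
    refine Real.rpow_le_rpow_of_exponent_le (by norm_num) ?_
    have := (abs_le.1 hx.2.2).1
    simp only [f] at this
    linarith

end Equipartition

/-! ### Achievability and converse -/

lemma tendsto_const_mul_two_rpow_neg (c : ℝ) {δ : ℝ} (hδ : 0 < δ) :
    Tendsto (fun m : ℕ => c * (2 : ℝ) ^ (-(m * δ))) atTop (𝓝 0) := by
  have h : Tendsto (fun m : ℕ => c * ((2 : ℝ) ^ (-δ)) ^ m) atTop (𝓝 (c * 0)) :=
    (tendsto_pow_atTop_nhds_zero_of_lt_one (by positivity)
      (Real.rpow_lt_one_of_one_lt_of_neg (by norm_num) (by linarith))).const_mul c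
  rw [mul_zero] at h
  refine h.congr fun m => ?_
  rw [← Real.rpow_natCast, ← Real.rpow_mul (by norm_num)]
  ring_nf

section Coding

variable {Ω S F : Type*} [MeasurableSpace Ω] [Fintype S] [MeasurableSpace S]
  [DiscreteMeasurableSpace S] [Field F] [Fintype F] {μ : Measure Ω} [IsProbabilityMeasure μ]
  {X : ℕ → Ω → S} {P : Matrix S S ℝ} {π : S → ℝ}

lemma logb_two_card_pos (F : Type*) [Field F] [Fintype F] :
    0 < Real.logb 2 (Fintype.card F) :=
  Real.logb_pos (by norm_num) (by exact_mod_cast Fintype.one_lt_card)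

lemma card_pow_eq_two_rpow (F : Type*) [Field F] [Fintype F] (k : ℕ) :
    (Fintype.card F : ℝ) ^ k = 2 ^ (k * Real.logb 2 (Fintype.card F)) := by
  rw [mul_comm, Real.rpow_mul (by norm_num), Real.rpow_logb (by norm_num) (by norm_num)
    (by exact_mod_cast Fintype.card_pos), Real.rpow_natCast]

lemma IsMarkovChain.exists_forall_linearlyEncodable (hX : IsMarkovChain μ X P)
    (hP : P.IsIrreducible) (hπ : IsInvariantDistribution π P) {Φ : S → F}
    (hΦ : Function.Injective Φ) {R : ℝ} (hR : condEntropy P π < R) {ε : ℝ} (hε : 0 < ε) :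
    ∃ N₀ : ℕ, ∀ n : ℕ, N₀ < n → ∀ k : ℕ,
      (n : ℝ) * R / Real.logb 2 (Fintype.card F) ≤ (k : ℝ) → LinearlyEncodable μ X Φ n k ε := by
  classical
  obtain ⟨ω₀⟩ := nonempty_of_isProbabilityMeasure μ
  obtain ⟨T, hT0, hTcard, -⟩ :=
    exists_typicalSet hX hP hπ (δ := (R - condEntropy P π) / 2) (by linarith)
  -- the factor `2 ^ (-R)` accounts for a block of `m + 1` letters making only `m` transitions
  have hlim := hT0.add (tendsto_const_mul_two_rpow_neg (Fintype.card S * (2 : ℝ) ^ (-R))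
    (δ := (R - condEntropy P π) / 2) (by linarith))
  rw [add_zero] at hlim
  obtain ⟨N, hN⟩ := eventually_atTop.1 (hlim.eventually_lt_const hε)
  refine ⟨N, fun n hn k hk => ?_⟩
  obtain ⟨m, rfl⟩ : ∃ m, n = m + 1 := ⟨n - 1, by omega⟩
  have htotal : ∑ x, μ.real {ω | block X (m + 1) ω = x} ≤ 1 := by
    have h := hX.measureReal_block_mem (m + 1) (fun _ => True)
    simp only [filter_true] at h
    rw [← h]
    exact measureReal_le_one
  obtain ⟨A, ψ, hA⟩ := exists_linear_code hΦ (fun x => measureReal_nonneg) htotal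
    ⟨X 0 ω₀⟩ (T m) k
  refine ⟨A, ψ, ?_⟩
  rw [hX.measureReal_block_mem (m + 1) (fun x => ψ (A *ᵥ (Φ ∘ x)) ≠ x)]
  refine hA.trans_lt (lt_of_le_of_lt ?_ (hN m (by omega)))
  rw [← hX.measureReal_block_mem (m + 1) (fun x => x ∉ T m)]
  gcongr
  have hpow : (2 : ℝ) ^ ((m + 1 : ℕ) * R) ≤ (Fintype.card F : ℝ) ^ k := by
    rw [card_pow_eq_two_rpow]
    exact Real.rpow_le_rpow_of_exponent_le (by norm_num)
      ((div_le_iff₀ (logb_two_card_pos F)).1 hk)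
  calc (#(T m) : ℝ) / (Fintype.card F : ℝ) ^ k
      ≤ (Fintype.card S * 2 ^ (m * (condEntropy P π + (R - condEntropy P π) / 2))) /
          (2 : ℝ) ^ ((m + 1 : ℕ) * R) :=
        div_le_div₀ (by positivity) (hTcard m) (by positivity) hpow
    _ = _ := by
        rw [mul_div_assoc, mul_assoc, ← Real.rpow_sub (by norm_num),
          ← Real.rpow_add (by norm_num)]
        push_cast
        ring_nf

/-- The largest admissible `k`, namely `⌊n R / log₂ |F|⌋`, eventually exceeds
`n R' / log₂ |F|` for `R'` halfway between the entropy and `R`. -/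
lemma IsMarkovChain.linearlyAchievable (hX : IsMarkovChain μ X P)
    (hP : P.IsIrreducible) (hπ : IsInvariantDistribution π P) {Φ : S → F}
    (hΦ : Function.Injective Φ) {R : ℝ} (hR : condEntropy P π < R) :
    LinearlyAchievable μ X Φ R := by
  intro ε hε
  have hH := condEntropy_nonneg hX.nonneg hX.row_sum hπ
  set H := condEntropy P π
  obtain ⟨N, hN⟩ := hX.exists_forall_linearlyEncodable hP hπ hΦ (R := (H + R) / 2)
    (by simp only [H] at hR ⊢; linarith) hε
  set L := Real.logb 2 (Fintype.card F) with hL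
  have hLpos : 0 < L := logb_two_card_pos F
  refine ⟨max N ⌈2 * L / (R - H)⌉₊, fun n hn => ⟨⌊n * R / L⌋₊, ?_, hN n ?_ _ ?_⟩⟩
  · rw [card_pow_eq_two_rpow]
    refine Real.rpow_le_rpow_of_exponent_le (by norm_num) ?_
    rw [← le_div_iff₀ hLpos]
    have : 0 ≤ R := by linarith
    exact Nat.floor_le (by positivity)
  · exact (le_max_left _ _).trans_lt hn
  · have h1 : 2 * L ≤ n * (R - H) := by
      rw [← div_le_iff₀ (by linarith)]
      exact (Nat.le_ceil _).trans (by exact_mod_cast ((le_max_right _ _).trans hn.le))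
    have h2 : n * ((H + R) / 2) / L ≤ n * R / L - 1 := by
      rw [div_le_iff₀ hLpos, sub_mul, div_mul_cancel₀ _ hLpos.ne']
      linarith
    exact h2.trans (Nat.sub_one_lt_floor _).le

/-- Below the entropy the probability of correct decoding tends to zero: at most `2 ^ (n R)` words
are decoded correctly, and each typical one has probability at most about
`2 ^ (-n H)`. -/
lemma IsMarkovChain.not_achievable (hX : IsMarkovChain μ X P)
    (hP : P.IsIrreducible) (hπ : IsInvariantDistribution π P) {R : ℝ}
    (hR : R < condEntropy P π) : ¬ Achievable μ X R := by
  classical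
  intro hach
  obtain ⟨N, hN⟩ := hach (1 / 2) (by norm_num)
  obtain ⟨T, hT0, -, hTprob⟩ :=
    exists_typicalSet hX hP hπ (δ := (condEntropy P π - R) / 2) (by linarith)
  have hlim := hT0.add (tendsto_const_mul_two_rpow_neg ((2 : ℝ) ^ R)
    (δ := (condEntropy P π - R) / 2) (by linarith))
  rw [add_zero] at hlim
  obtain ⟨N', hN'⟩ := eventually_atTop.1 (hlim.eventually_lt_const (u := 1 / 2) (by norm_num))
  set H := condEntropy P π
  set m := max N N'
  obtain ⟨φ, ψ, herr⟩ := hN (m + 1) (by omega)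
  have hsmall := hN' m (by omega)
  set G : Finset (Fin (m + 1) → S) := {x | ψ (φ x) = x}
  have hG : (#G : ℝ) ≤ 2 ^ ((m + 1 : ℕ) * R) := by
    have h1 : G ⊆ univ.image ψ := fun x hx =>
      mem_image.2 ⟨φ x, mem_univ _, (mem_filter.1 hx).2⟩
    have h2 := (card_le_card h1).trans card_image_le
    rw [card_univ, Fintype.card_fin] at h2
    exact (Nat.cast_le.2 h2).trans (Nat.floor_le (by positivity))
  have hGT : μ.real {ω | block X (m + 1) ω ∈ G ∩ T m} ≤
      2 ^ R * 2 ^ (-(m * ((H - R) / 2))) := by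
    rw [hX.measureReal_block_mem (m + 1) (fun x => x ∈ G ∩ T m)]
    calc ∑ x with x ∈ G ∩ T m, μ.real {ω | block X (m + 1) ω = x}
        ≤ ∑ x with x ∈ G ∩ T m, (2 : ℝ) ^ (-(m * (H - (H - R) / 2))) :=
          sum_le_sum fun x hx => hTprob m x (mem_inter.1 (mem_filter.1 hx).2).2
      _ ≤ 2 ^ ((m + 1 : ℕ) * R) * (2 : ℝ) ^ (-(m * (H - (H - R) / 2))) := by
          rw [sum_const, nsmul_eq_mul]
          refine mul_le_mul_of_nonneg_right (le_trans ?_ hG) (by positivity)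
          exact_mod_cast card_le_card fun x hx => (mem_inter.1 (mem_filter.1 hx).2).1
      _ = 2 ^ R * 2 ^ (-(m * ((H - R) / 2))) := by
          rw [← Real.rpow_add (by norm_num), ← Real.rpow_add (by norm_num)]
          congr 1
          push_cast
          ring
  have hcover : (Set.univ : Set Ω) ⊆ {ω | ψ (φ (block X (m + 1) ω)) ≠ block X (m + 1) ω} ∪
      ({ω | block X (m + 1) ω ∉ T m} ∪ {ω | block X (m + 1) ω ∈ G ∩ T m}) := by
    intro ω _
    by_cases h1 : ψ (φ (block X (m + 1) ω)) = block X (m + 1) ω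
    · by_cases h2 : block X (m + 1) ω ∈ T m
      · exact Or.inr (Or.inr (mem_inter.2 ⟨mem_filter.2 ⟨mem_univ _, h1⟩, h2⟩))
      · exact Or.inr (Or.inl h2)
    · exact Or.inl h1
  have h1 := measureReal_mono (μ := μ) hcover
  rw [probReal_univ] at h1
  have h2 := h1.trans ((measureReal_union_le _ _).trans
    (add_le_add le_rfl (measureReal_union_le _ _)))
  linarith

end Coding

end MarkovCoding

theorem mainTheorem7 {Ω S F : Type*} [MeasurableSpace Ω]
    [Fintype S] [MeasurableSpace S] [DiscreteMeasurableSpace S]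
    [Field F] [Fintype F]
    (μ : MeasureTheory.Measure Ω) [MeasureTheory.IsProbabilityMeasure μ]
    (X : ℕ → Ω → S) (P : Matrix S S ℝ) (π : S → ℝ)
    (hX : MarkovCoding.IsMarkovChain μ X P) (hP : P.IsIrreducible)
    (hπ : MarkovCoding.IsInvariantDistribution π P) :
    (∀ Φ : S → F, Function.Injective Φ → ∀ R : ℝ, MarkovCoding.condEntropy P π < R →
      MarkovCoding.LinearlyAchievable μ X Φ R ∧
      ∀ ε : ℝ, 0 < ε → ∃ N₀ : ℕ, ∀ n : ℕ, N₀ < n → ∀ k : ℕ,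
        (n : ℝ) * R / Real.logb 2 (Fintype.card F) ≤ (k : ℝ) →
          MarkovCoding.LinearlyEncodable μ X Φ n k ε) ∧
    (∀ R : ℝ, R < MarkovCoding.condEntropy P π → ¬ MarkovCoding.Achievable μ X R) := by
  exact ⟨fun Φ hΦ R hR => ⟨hX.linearlyAchievable hP hπ hΦ hR, fun ε hε =>
    hX.exists_forall_linearlyEncodable hP hπ hΦ hR hε⟩, fun R hR => hX.not_achievable hP hπ hR⟩
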